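/- Let $P$ be an infinite field, let $n \ge 0$ be an integer, and let $P[X] = P[x_1,\dots,x_n]$ be the polynomial algebra over $P$ in $n$ commuting variables. Let $\mathrm{End}(P[X])$ be the semigroup, under composition, of all endomorphisms of the unital $P$-algebra $P[X]$. Then every automorphism $\tau$ of the semigroup $\mathrm{End}(P[X])$ is semi-inner. That is, there are an automorphism $\alpha$ of the field $P$ and a $P$-algebra automorphism $\eta$ of $P[X]$ such that, for the bijection $\mu = \overline{\alpha} \circ \eta$ of $P[X]$, $$\tau(s) = \mu \circ s \circ \mu^{-1} \qquad \text{for every } s \in \mathrm{End}(P[X]),$$ where $\overline{\alpha}$ is the extension of $\alpha$ to $P[X]$ coefficientwise: $\overline{\alpha}\left(\sum_k a_k u_k\right) = \sum_k \alpha(a_k) u_k$ for $a_k \in P$ and monomials $u_k$. -/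

import Mathlib

/-- The bijection `μ = α η` of `P[x₁, …, xₙ]`: first the `P`-algebra automorphism `η`, then the
field automorphism `α` of `P`, extended to polynomials coefficientwise. -/
noncomputable def semiInnerBijection {P : Type*} [Field P] {n : ℕ} (α : P ≃+* P)
    (η : MvPolynomial (Fin n) P ≃ₐ[P] MvPolynomial (Fin n) P) :
    MvPolynomial (Fin n) P ≃ MvPolynomial (Fin n) P :=
  η.toEquiv.trans (MvPolynomial.mapEquiv (Fin n) α).toEquiv

/-- A bijection `μ` of `P[x₁, …, xₙ]` generates the automorphism `τ` of the semigroup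
`End(P[x₁, …, xₙ])` (endomorphisms of the `P`-algebra, under composition) if
`τ(s) = μ s μ⁻¹` for every endomorphism `s`. -/
def Generates {P : Type*} [Field P] {n : ℕ}
    (μ : MvPolynomial (Fin n) P ≃ MvPolynomial (Fin n) P)
    (τ : (MvPolynomial (Fin n) P →ₐ[P] MvPolynomial (Fin n) P) ≃*
      (MvPolynomial (Fin n) P →ₐ[P] MvPolynomial (Fin n) P)) : Prop :=
  ∀ s : MvPolynomial (Fin n) P →ₐ[P] MvPolynomial (Fin n) P, ⇑(τ s) = μ ∘ s ∘ μ.symm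

/-- An automorphism of the semigroup `End(P[x₁, …, xₙ])` is semi-inner if it is generated by a
bijection `α η` with `α ∈ Aut(P)` and `η ∈ Aut(P[x₁, …, xₙ])`. -/
def IsSemiInner {P : Type*} [Field P] {n : ℕ}
    (τ : (MvPolynomial (Fin n) P →ₐ[P] MvPolynomial (Fin n) P) ≃*
      (MvPolynomial (Fin n) P →ₐ[P] MvPolynomial (Fin n) P)) : Prop :=
  ∃ (α : P ≃+* P) (η : MvPolynomial (Fin n) P ≃ₐ[P] MvPolynomial (Fin n) P),
    Generates (semiInnerBijection α η) τ

/-!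
The right zeros of the semigroup, the substitutions of points for the variables, are permuted by
`τ`. This gives a permutation `σ` of affine space that conjugates the polynomial map dual to `s`
into the one dual to `τ s`; the theorem amounts to `σ` being, up to a field automorphism acting on
coordinates, a polynomial map with a polynomial inverse.

The idempotents whose image is a polynomial algebra in one variable can be recognized inside the
semigroup: they are the nonconstant idempotents `e` such that products of nonconstant elements of
`e End(P[X]) e` are nonconstant. Indeed, for such an `e` a line through two points of the image of
its dual map embeds the retract `e(P[X])` into `P[t]`, and by Costa's theorem a retract of
transcendence degree one is a polynomial ring. So `τ` sends the projection of affine space onto its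
diagonal to a retraction onto a curve that is polynomially parametrized by the affine line, and `σ`
induces a permutation of `P`. This permutation conjugates affine maps to invertible polynomial maps
of the line, that is to affine maps, and hence is itself a field automorphism followed by an affine
map. Comparing any point with its coordinates, placed on the diagonal, carries this over to `σ`.
-/

section Retract

open Polynomial

variable {k A B ι : Type*} [Field k] [CommRing A] [Algebra k A] [CommRing B] [Algebra k B]

theorem exists_ne_zero_dvd_aeval_of_trdeg_le_one [IsDomain A] (htr : Algebra.trdeg k A ≤ 1)
    (f : A) {h : A} (hh : h ≠ 0) : ∃ p : k[X], p ≠ 0 ∧ h ∣ aeval f p := by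
  by_cases hf : IsAlgebraic k f
  · obtain ⟨p, hp, hpf⟩ := hf
    exact ⟨p, hp, hpf ▸ dvd_zero h⟩
  · have hind : AlgebraicIndependent k fun _ : Unit => f :=
      (algebraicIndependent_unique_type_iff (x := fun _ => f)).2 hf
    have halg := (hind.isTranscendenceBasis_of_lift_trdeg_le_of_finite
      (by simpa using htr)).isAlgebraic
    obtain ⟨⟨r, hr⟩, hr0, hhr⟩ :=
      (halg.isAlgebraic h).exists_nonzero_dvd (mem_nonZeroDivisors_of_ne_zero hh)
    rw [Set.range_const, Algebra.adjoin_singleton_eq_range_aeval] at hr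
    obtain ⟨p, rfl⟩ := hr
    exact ⟨p, fun hp => hr0 (Subtype.ext (by simp [hp])), hhr⟩

theorem exists_eq_X_pow_mul_coeff_zero_ne_zero {R : Type*} [CommRing R] {p : R[X]} (hp : p ≠ 0) :
    ∃ (n : ℕ) (g : R[X]), p = X ^ n * g ∧ g.coeff 0 ≠ 0 := by
  obtain ⟨g, hpg, hg⟩ := exists_eq_pow_rootMultiplicity_mul_and_not_dvd p hp 0
  rw [C_0, sub_zero] at hpg hg
  exact ⟨_, g, hpg, mt X_dvd_iff.2 hg⟩

theorem algHom_aeval_eq_coeff_zero {R S : Type*} [CommSemiring R] [Semiring S] [Algebra R S]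
    (ε : S →ₐ[R] R) {f : S} (hf : ε f = 0) (p : R[X]) : ε (aeval f p) = p.coeff 0 := by
  rw [← aeval_algHom_apply, hf, ← coeff_zero_eq_aeval_zero]

theorem dvd_of_prime_of_dvd_aeval {R : Type*} [CommRing R] [Algebra R B] {q f : B}
    (hq : Prime q) (ε : B →ₐ[R] R) (hqε : ε q = 0)
    (hf : ε f = 0) {p : R[X]} (hp : p ≠ 0) (hqp : q ∣ aeval f p) : q ∣ f := by
  obtain ⟨n, g, rfl, hg⟩ := exists_eq_X_pow_mul_coeff_zero_ne_zero hp
  rw [map_mul, map_pow, aeval_X] at hqp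
  refine hq.dvd_of_dvd_pow ((hq.dvd_or_dvd hqp).resolve_right fun hqg => hg ?_)
  rw [← algHom_aeval_eq_coeff_zero ε hf, ← zero_dvd_iff, ← hqε]
  exact map_dvd ε hqg

theorem exists_prime_dvd_mem_of_isPrime {R : Type*} [CommSemiring R]
    [UniqueFactorizationMonoid R] {I : Ideal R} (hI : I.IsPrime) {h : R} (hhI : h ∈ I)
    (hh : h ≠ 0) : ∃ q ∈ I, Prime q ∧ q ∣ h := by
  obtain ⟨m, hm, hmh⟩ := UniqueFactorizationMonoid.exists_prime_factors h hh
  obtain ⟨q, hqm, hqI⟩ :=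
    (hI.multiset_prod_mem_iff_exists_mem m).1 ((I.mem_iff_of_associated hmh).2 hhI)
  exact ⟨q, hqI, hm q hqm, (Multiset.dvd_prod hqm).trans hmh.dvd⟩

/-- Let `q` be a prime factor of `i h` lying in the kernel of `ε ∘ r`, where `h ≠ 0` is in the
kernel of `ε`. Any `f` in the kernel of `ε` is algebraically dependent on `h`, which forces `q` to
divide `i f`; so `r q` is a generator. -/
theorem exists_ker_eq_span_singleton_of_retract [IsDomain B] [UniqueFactorizationMonoid B]
    (i : A →ₐ[k] B) (r : B →ₐ[k] A) (hri : Function.LeftInverse r i)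
    (htr : Algebra.trdeg k A ≤ 1) (ε : A →ₐ[k] k) :
    ∃ s, RingHom.ker ε = Ideal.span {s} := by
  have hi : Function.Injective i := hri.injective
  have : IsDomain A := hi.isDomain i
  by_cases hbot : RingHom.ker ε = ⊥
  · exact ⟨0, by rw [hbot, Ideal.span_singleton_zero]⟩
  obtain ⟨h, hhε, hh⟩ := Submodule.exists_mem_ne_zero_of_ne_bot hbot
  obtain ⟨q, hqε, hq, hqh⟩ := exists_prime_dvd_mem_of_isPrime (RingHom.ker_isPrime (ε.comp r))
    (by simpa [hri _] using hhε) ((map_ne_zero_iff i hi).2 hh)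
  refine ⟨r q, le_antisymm (fun f hf => ?_) ?_⟩
  · obtain ⟨p, hp, hhp⟩ := exists_ne_zero_dvd_aeval_of_trdeg_le_one htr f hh
    have hqp : q ∣ aeval (i f) p := hqh.trans (by simpa [aeval_algHom_apply] using map_dvd i hhp)
    have hqf : q ∣ i f :=
      dvd_of_prime_of_dvd_aeval hq (ε.comp r) hqε (by simpa [hri _] using hf) hp hqp
    simpa only [Ideal.mem_span_singleton, hri f] using map_dvd r hqf
  · rw [Ideal.span_singleton_le_iff_mem]
    exact hqε

theorem aeval_injective_of_algHom_eq_zero {R : Type*} [CommRing R] [Algebra R A] [IsDomain A]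
    (ε : A →ₐ[R] R) {s : A} (hs : s ≠ 0) (hε : ε s = 0) :
    Function.Injective (aeval s : R[X] →ₐ[R] A) := by
  refine (injective_iff_map_eq_zero _).2 fun p hp => ?_
  by_contra hp0
  obtain ⟨n, g, rfl, hg⟩ := exists_eq_X_pow_mul_coeff_zero_ne_zero hp0
  rw [map_mul, map_pow, aeval_X, mul_eq_zero_iff_left (pow_ne_zero n hs)] at hp
  exact hg (by rw [← algHom_aeval_eq_coeff_zero ε hε, hp, map_zero])

theorem aeval_surjective_of_ker_eq_span_singleton (i : A →ₐ[k] MvPolynomial ι k)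
    (hi : Function.Injective i) (ε : A →ₐ[k] k) {s : A} (hs : s ≠ 0)
    (hker : RingHom.ker ε = Ideal.span {s}) :
    Function.Surjective (aeval s : k[X] →ₐ[k] A) := by
  have hsε : ε s = 0 := RingHom.mem_ker.1 (hker ▸ Ideal.mem_span_singleton_self s)
  have hsdeg : (i s).totalDegree ≠ 0 := by
    intro h
    obtain ⟨a, ha⟩ : ∃ a, i s = algebraMap k _ a :=
      ⟨_, MvPolynomial.totalDegree_eq_zero_iff_eq_C.1 h⟩
    obtain rfl : s = algebraMap k A a := hi (by rw [ha, i.commutes])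
    rw [ε.commutes, Algebra.algebraMap_self_apply] at hsε
    exact hs (by rw [hsε, map_zero])
  intro f
  induction hd : (i f).totalDegree using Nat.strong_induction_on generalizing f with
  | _ d ih =>
    have hmem : f - algebraMap k A (ε f) ∈ RingHom.ker ε := by simp
    rw [hker, Ideal.mem_span_singleton] at hmem
    obtain ⟨g, hfg⟩ := hmem
    obtain ⟨p, rfl⟩ : ∃ p, aeval s p = g := by
      by_cases hg : g = 0
      · exact ⟨0, by rw [hg, map_zero]⟩
      refine ih _ ?_ g rfl
      have hdeg := MvPolynomial.totalDegree_mul_of_isDomain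
        ((map_ne_zero_iff i hi).2 hs) ((map_ne_zero_iff i hi).2 hg)
      rw [← map_mul, ← hfg, map_sub, i.commutes] at hdeg
      have hle := MvPolynomial.totalDegree_sub_C_le (i f) (ε f)
      rw [← MvPolynomial.algebraMap_eq] at hle
      lia
    exact ⟨X * p + C (ε f), by simp [← hfg]⟩

/-- D. L. Costa, *Retracts of polynomial rings*, J. Algebra 44 (1977). -/
theorem nonempty_algEquiv_polynomial_of_retract (i : A →ₐ[k] MvPolynomial ι k)
    (r : MvPolynomial ι k →ₐ[k] A) (hri : Function.LeftInverse r i)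
    (htr : Algebra.trdeg k A ≤ 1) (hA : ¬ Function.Surjective (algebraMap k A)) :
    Nonempty (k[X] ≃ₐ[k] A) := by
  have hi : Function.Injective i := hri.injective
  have : IsDomain A := hi.isDomain i
  let ε : A →ₐ[k] k := (MvPolynomial.aeval (0 : ι → k)).comp i
  obtain ⟨s, hker⟩ := exists_ker_eq_span_singleton_of_retract i r hri htr ε
  have hs : s ≠ 0 := by
    rintro rfl
    rw [Ideal.span_singleton_zero] at hker
    exact hA fun f => ⟨ε f, (RingHom.injective_iff_ker_eq_bot ε).2 hker (ε.commutes _)⟩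
  have hε : ε s = 0 := RingHom.mem_ker.1 (hker ▸ Ideal.mem_span_singleton_self s)
  exact ⟨AlgEquiv.ofBijective (aeval s) ⟨aeval_injective_of_algHom_eq_zero ε hs hε,
    aeval_surjective_of_ker_eq_span_singleton i hi ε hs hker⟩⟩

end Retract

section PointMap

open MvPolynomial
open scoped Polynomial

variable {R ι κ : Type*} [CommSemiring R]

/-- The semigroup `End(R[X])` of endomorphisms of the `R`-algebra of polynomials in the variables
`ι`; its multiplication is composition. -/
abbrev PolyEnd (ι R : Type*) [CommSemiring R] : Type _ :=
  MvPolynomial ι R →ₐ[R] MvPolynomial ι R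

/-- The polynomial map of affine spaces dual to a homomorphism of polynomial algebras. Duality
reverses the order of composition. -/
noncomputable def pointMap (s : MvPolynomial ι R →ₐ[R] MvPolynomial κ R) (v : κ → R) : ι → R :=
  fun i => eval v (s (X i))

/-- The polynomial curve in affine space dual to a homomorphism into polynomials in one variable. -/
noncomputable def curve (r : MvPolynomial ι R →ₐ[R] R[X]) (t : R) : ι → R :=
  fun i => (r (X i)).eval t

theorem eval_algHom_apply (s : MvPolynomial ι R →ₐ[R] MvPolynomial κ R) (v : κ → R)
    (p : MvPolynomial ι R) : eval v (s p) = eval (pointMap s v) p :=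
  DFunLike.congr_fun (aeval_unique ((aeval v : MvPolynomial κ R →ₐ[R] R).comp s)) p

theorem polynomial_eval_algHom_apply (r : MvPolynomial ι R →ₐ[R] R[X]) (t : R)
    (p : MvPolynomial ι R) : (r p).eval t = eval (curve r t) p :=
  DFunLike.congr_fun (aeval_unique ((Polynomial.aeval t).comp r)) p

theorem eval_algHom_polynomial_apply (i : R[X] →ₐ[R] MvPolynomial ι R) (v : ι → R) (p : R[X]) :
    eval v (i p) = p.eval (eval v (i Polynomial.X)) := by
  have h : (aeval v).comp i = Polynomial.aeval (eval v (i Polynomial.X)) := by ext; simp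
  exact DFunLike.congr_fun h p

theorem curve_eval (i : R[X] →ₐ[R] MvPolynomial ι R)
    (r : MvPolynomial ι R →ₐ[R] R[X]) (v : ι → R) :
    curve r (eval v (i Polynomial.X)) = pointMap (i.comp r) v :=
  funext fun j => (eval_algHom_polynomial_apply i v (r (X j))).symm

theorem eval_curve_of_leftInverse {i : R[X] →ₐ[R] MvPolynomial ι R}
    {r : MvPolynomial ι R →ₐ[R] R[X]} (hri : Function.LeftInverse r i) (t : R) :
    eval (curve r t) (i Polynomial.X) = t := by
  rw [← polynomial_eval_algHom_apply, hri, Polynomial.eval_X]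

theorem pointMap_one (v : ι → R) : pointMap (1 : PolyEnd ι R) v = v :=
  funext fun i => eval_X i

theorem pointMap_mul (s t : PolyEnd ι R) (v : ι → R) :
    pointMap (s * t) v = pointMap t (pointMap s v) :=
  funext fun i => eval_algHom_apply s v (t (X i))

theorem pointMap_injective {R : Type*} [CommRing R] [IsDomain R] [Infinite R] :
    Function.Injective
      (pointMap : (MvPolynomial ι R →ₐ[R] MvPolynomial κ R) → (κ → R) → ι → R) :=
  fun _ _ h => algHom_ext fun i => MvPolynomial.funext fun v => congrFun (congrFun h v) i

end PointMap

section Constants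

open MvPolynomial

variable {R ι : Type*} [CommSemiring R]

/-- The endomorphism substituting the point `c` for the variables, dual to the constant map `c`. -/
noncomputable def constEnd (c : ι → R) : PolyEnd ι R :=
  aeval fun i => C (c i)

theorem constEnd_apply (c : ι → R) (p : MvPolynomial ι R) : constEnd c p = C (eval c p) := by
  have h : constEnd c = (Algebra.ofId R _).comp (aeval c) := by
    ext1
    simp [constEnd, Algebra.ofId_apply]
  exact DFunLike.congr_fun h p

@[simp]
theorem pointMap_constEnd (c v : ι → R) : pointMap (constEnd c) v = c := by
  funext i
  simp [pointMap, constEnd]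

theorem constEnd_injective : Function.Injective (constEnd : (ι → R) → PolyEnd ι R) :=
  fun c d h => by simpa using congrArg (pointMap · 0) h

theorem constEnd_mul (c : ι → R) (s : PolyEnd ι R) :
    constEnd c * s = constEnd (pointMap s c) := by
  ext1 i
  simp [constEnd_apply, pointMap]

theorem mul_constEnd (s : PolyEnd ι R) (c : ι → R) : s * constEnd c = constEnd c := by
  ext1 i
  simp [constEnd]

theorem mem_range_constEnd_iff {s : PolyEnd ι R} :
    s ∈ Set.range constEnd ↔ ∀ t, t * s = s :=
  ⟨by rintro ⟨c, rfl⟩ t; exact mul_constEnd t c,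
    fun h => ⟨pointMap s 0, by rw [← constEnd_mul, h]⟩⟩

theorem map_mem_range_constEnd_iff (τ : PolyEnd ι R ≃* PolyEnd ι R) {s : PolyEnd ι R} :
    τ s ∈ Set.range constEnd ↔ s ∈ Set.range constEnd := by
  rw [mem_range_constEnd_iff, mem_range_constEnd_iff, τ.surjective.forall]
  simp only [← map_mul, τ.injective.eq_iff]

theorem exists_perm_semiconj_pointMap (τ : PolyEnd ι R ≃* PolyEnd ι R) :
    ∃ σ : Equiv.Perm (ι → R), ∀ s, Function.Semiconj σ (pointMap s) (pointMap (τ s)) := by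
  have hτ (τ : PolyEnd ι R ≃* PolyEnd ι R) (c : ι → R) : ∃ d, constEnd d = τ (constEnd c) :=
    (map_mem_range_constEnd_iff τ).2 ⟨c, rfl⟩
  choose f hf using hτ τ
  choose g hg using hτ τ.symm
  refine ⟨⟨f, g, fun c => ?_, fun c => ?_⟩, fun s c => ?_⟩ <;> apply constEnd_injective
  · rw [hg, hf, MulEquiv.symm_apply_apply]
  · rw [hf, hg, MulEquiv.apply_symm_apply]
  · rw [Equiv.coe_fn_mk, ← constEnd_mul, hf, hf, ← map_mul, constEnd_mul]

end Constants

section Splitting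

open MvPolynomial
open scoped Polynomial

variable {R ι : Type*} [CommSemiring R]

/-- An endomorphism `e` of `R[X]` splits through `R[t]` if it factors as `R[X] → R[t] → R[X]` with
`R[t] → R[X] → R[t]` the identity. Such an `e` is idempotent and its image is a polynomial algebra
in one variable. -/
def SplitsThroughPolynomial (e : PolyEnd ι R) : Prop :=
  ∃ (i : R[X] →ₐ[R] MvPolynomial ι R) (r : MvPolynomial ι R →ₐ[R] R[X]),
    Function.LeftInverse r i ∧ i.comp r = e

/-- In the semigroup `e End(R[X]) e`, products of nonconstant elements are nonconstant. For an
idempotent `e` this expresses, in terms of the semigroup `End(R[X])` alone, that the image of `e`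
has dimension at most one. -/
def IsCurveLike (e : PolyEnd ι R) : Prop :=
  ∀ s t, e * s * e * t * e ∈ Set.range constEnd →
    e * s * e ∈ Set.range constEnd ∨ e * t * e ∈ Set.range constEnd

theorem isCurveLike_map_iff (τ : PolyEnd ι R ≃* PolyEnd ι R) {e : PolyEnd ι R} :
    IsCurveLike (τ e) ↔ IsCurveLike e := by
  rw [IsCurveLike, IsCurveLike, τ.surjective.forall₂]
  simp only [← map_mul, map_mem_range_constEnd_iff]

theorem polynomial_algHom_apply_of_apply_X_eq_C {p : R[X] →ₐ[R] R[X]} {a : R}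
    (hp : p Polynomial.X = Polynomial.C a) (f : R[X]) : p f = Polynomial.C (f.eval a) := by
  have h : p = (Algebra.ofId R R[X]).comp (Polynomial.aeval a) := by
    ext1
    simp [hp, Algebra.ofId_apply]
  exact DFunLike.congr_fun h f

theorem comp_comp_eq_constEnd (i : R[X] →ₐ[R] MvPolynomial ι R)
    (r : MvPolynomial ι R →ₐ[R] R[X]) {p : R[X] →ₐ[R] R[X]} {a : R}
    (hp : p Polynomial.X = Polynomial.C a) : i.comp (p.comp r) = constEnd (curve r a) := by
  ext1 j
  simp only [AlgHom.comp_apply, polynomial_algHom_apply_of_apply_X_eq_C hp, constEnd, aeval_X,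
    curve]
  exact i.commutes _

theorem polynomial_algHom_constEnd (r : MvPolynomial ι R →ₐ[R] R[X]) (c : ι → R)
    (f : MvPolynomial ι R) : r (constEnd c f) = Polynomial.C (eval c f) := by
  rw [constEnd_apply]
  exact r.commutes _

theorem SplitsThroughPolynomial.notMem_range_constEnd [Nontrivial R] {e : PolyEnd ι R}
    (he : SplitsThroughPolynomial e) : e ∉ Set.range constEnd := by
  rintro ⟨c, rfl⟩
  obtain ⟨i, r, hri, hir⟩ := he
  have hX : (Polynomial.X : R[X]) = Polynomial.C (eval c (i Polynomial.X)) :=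
    calc Polynomial.X = r (constEnd c (i Polynomial.X)) := by
          rw [← hir, AlgHom.comp_apply, hri, hri]
      _ = Polynomial.C (eval c (i Polynomial.X)) := polynomial_algHom_constEnd r c _
  exact Polynomial.X_ne_C _ hX

theorem SplitsThroughPolynomial.isCurveLike [NoZeroDivisors R] {e : PolyEnd ι R}
    (he : SplitsThroughPolynomial e) : IsCurveLike e := by
  obtain ⟨i, r, hri, rfl⟩ := he
  rintro s t ⟨c, hc⟩
  let p : R[X] →ₐ[R] R[X] := r.comp (s.comp i)
  let q : R[X] →ₐ[R] R[X] := r.comp (t.comp i)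
  have hpq : (q Polynomial.X).comp (p Polynomial.X) = Polynomial.C (eval c (i Polynomial.X)) :=
    calc (q Polynomial.X).comp (p Polynomial.X) = p (q Polynomial.X) := by
          rw [Polynomial.comp_eq_aeval, Polynomial.aeval_algHom_apply,
            Polynomial.aeval_X_left_apply]
      _ = r (constEnd c (i Polynomial.X)) := by
          rw [hc]
          simp only [AlgHom.mul_apply, AlgHom.comp_apply, hri _, p, q]
      _ = Polynomial.C (eval c (i Polynomial.X)) := polynomial_algHom_constEnd r c _
  have hdeg : (q Polynomial.X).natDegree * (p Polynomial.X).natDegree = 0 := by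
    rw [← Polynomial.natDegree_comp, hpq, Polynomial.natDegree_C]
  rcases mul_eq_zero.1 hdeg with hq | hp
  · exact .inr ⟨_, (comp_comp_eq_constEnd i r (Polynomial.eq_C_of_natDegree_eq_zero hq)).symm⟩
  · exact .inl ⟨_, (comp_comp_eq_constEnd i r (Polynomial.eq_C_of_natDegree_eq_zero hp)).symm⟩

end Splitting

section CurveLikeIdempotents

open MvPolynomial
open scoped Polynomial

variable {R ι : Type*} [CommRing R]

/-- Restriction of polynomials to the line through `c` and `d`, parametrized so that `0` is sent to
`c` and `1` to `d`. -/
noncomputable def lineRestrict (c d : ι → R) : MvPolynomial ι R →ₐ[R] R[X] :=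
  aeval fun i => Polynomial.C (c i) + Polynomial.C (d i - c i) * Polynomial.X

/-- The endomorphism dual to the map `v ↦ (1 - f v) c + (f v) d` of affine space into the line
through `c` and `d`. -/
noncomputable def lineEnd (c d : ι → R) (f : MvPolynomial ι R) : PolyEnd ι R :=
  (Polynomial.aeval f).comp (lineRestrict c d)

theorem pointMap_lineEnd (c d : ι → R) (f : MvPolynomial ι R) (v : ι → R) :
    pointMap (lineEnd c d f) v = AffineMap.lineMap c d (eval v f) := by
  funext i
  simp [pointMap, lineEnd, lineRestrict, AffineMap.lineMap_apply, add_comm, mul_comm]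

theorem eval_left_of_lineRestrict_eq_zero {c d : ι → R} {f : MvPolynomial ι R}
    (hf : lineRestrict c d f = 0) : eval c f = 0 := by
  have hcurve : curve (lineRestrict c d) 0 = c := by
    funext i
    simp [curve, lineRestrict]
  rw [← hcurve, ← polynomial_eval_algHom_apply, hf, Polynomial.eval_zero]

theorem notMem_range_constEnd_of_pointMap_ne {s : PolyEnd ι R} {v w : ι → R}
    (h : pointMap s v ≠ pointMap s w) : s ∉ Set.range constEnd := by
  rintro ⟨c, rfl⟩
  simp at h

theorem lineEnd_mul_lineEnd_of_lineRestrict_eq_zero {c d : ι → R} {f g : MvPolynomial ι R}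
    (hg : lineRestrict c d g = 0) : lineEnd c d f * lineEnd c d g = constEnd c := by
  ext1 i
  have h (p : R[X]) : lineRestrict c d (Polynomial.aeval g p) = Polynomial.C (p.eval 0) := by
    rw [← Polynomial.aeval_algHom_apply, hg, ← Polynomial.coeff_zero_eq_aeval_zero',
      Polynomial.coeff_zero_eq_eval_zero]
    rfl
  simp only [lineEnd, AlgHom.mul_apply, AlgHom.comp_apply, h]
  simp [constEnd, lineRestrict]

theorem mul_lineEnd (s : PolyEnd ι R) (c d : ι → R) (f : MvPolynomial ι R) :
    s * lineEnd c d f = lineEnd c d (s f) := by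
  ext1 i
  simp [lineEnd, ← Polynomial.aeval_algHom_apply]

theorem exists_pointMap_eq_self_ne [IsDomain R] [Infinite R] {e : PolyEnd ι R}
    (he : IsIdempotentElem e) (hconst : e ∉ Set.range constEnd) :
    ∃ c₀ c₁, c₀ ≠ c₁ ∧ pointMap e c₀ = c₀ ∧ pointMap e c₁ = c₁ := by
  by_contra! h
  refine hconst ⟨pointMap e 0, pointMap_injective (funext fun v => ?_)⟩
  have hfix (v : ι → R) : pointMap e (pointMap e v) = pointMap e v := by rw [← pointMap_mul, he]
  rw [pointMap_constEnd]
  by_contra hne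
  exact h _ _ hne (hfix _) (hfix _)

variable {P : Type*} [Field P]

/-- If `w` vanished on the line through `c₀` and `c₁` but not at `c`, then, restricted to the image
of `e`, the nonconstant map that projects to this line would be collapsed to `c₀` by the nonconstant
map `lineEnd c₀ c₁ (w / w c)`. -/
theorem IsCurveLike.eq_zero_of_lineRestrict_eq_zero [Infinite P] {e : PolyEnd ι P}
    (hcurve : IsCurveLike e) {c₀ c₁ : ι → P} (hc : c₀ ≠ c₁)
    (h₀ : pointMap e c₀ = c₀) (h₁ : pointMap e c₁ = c₁) {w : MvPolynomial ι P} (hew : e w = w)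
    (hw : lineRestrict c₀ c₁ w = 0) : w = 0 := by
  by_contra hw0
  obtain ⟨c, hwc⟩ : ∃ c, eval c w ≠ 0 := by
    by_contra! h
    exact hw0 (MvPolynomial.funext fun v => by rw [h, map_zero])
  obtain ⟨j, hj⟩ := Function.ne_iff.1 hc
  let f : MvPolynomial ι P := C (c₁ j - c₀ j)⁻¹ * (X j - C (c₀ j))
  let g : MvPolynomial ι P := C (eval c w)⁻¹ * w
  have heg : e * lineEnd c₀ c₁ g = lineEnd c₀ c₁ g := by
    rw [mul_lineEnd, map_mul, hew, ← algebraMap_eq, e.commutes]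
    rfl
  have hgc₀ : eval c₀ g = 0 := by
    rw [map_mul, eval_left_of_lineRestrict_eq_zero hw, mul_zero]
  have hgc : eval c g = 1 := by simp [g, hwc]
  have hconst : e * lineEnd c₀ c₁ f * e * lineEnd c₀ c₁ g * e ∈ Set.range constEnd := by
    rw [mul_assoc (e * _), heg, mul_assoc e,
      lineEnd_mul_lineEnd_of_lineRestrict_eq_zero (by rw [map_mul, hw, mul_zero]), mul_constEnd,
      constEnd_mul]
    exact ⟨_, rfl⟩
  rcases hcurve _ _ hconst with h | h
  · refine notMem_range_constEnd_of_pointMap_ne (v := c₀) (w := c₁) ?_ h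
    simpa [pointMap_mul, pointMap_lineEnd, h₀, h₁, f, sub_ne_zero.2 (Ne.symm hj)] using hc
  · refine notMem_range_constEnd_of_pointMap_ne (v := c₀) (w := c) ?_ h
    simpa [heg, pointMap_mul, pointMap_lineEnd, h₀, h₁, hgc, hgc₀] using hc

theorem IsCurveLike.trdeg_range_le_one [Infinite P] {e : PolyEnd ι P} (he : IsIdempotentElem e)
    (hcurve : IsCurveLike e) (hconst : e ∉ Set.range constEnd) :
    Algebra.trdeg P e.range ≤ 1 := by
  obtain ⟨c₀, c₁, hc, h₀, h₁⟩ := exists_pointMap_eq_self_ne he hconst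
  have hinj : Function.Injective ((lineRestrict c₀ c₁).comp e.range.val) := by
    refine (injective_iff_map_eq_zero _).2 ?_
    rintro ⟨_, f, rfl⟩ hf
    exact Subtype.ext
      (hcurve.eq_zero_of_lineRestrict_eq_zero hc h₀ h₁ (DFunLike.congr_fun he f) hf)
  simpa using lift_trdeg_le_of_injective _ hinj

theorem IsCurveLike.splitsThroughPolynomial [Infinite P] {e : PolyEnd ι P}
    (he : IsIdempotentElem e) (hcurve : IsCurveLike e) (hconst : e ∉ Set.range constEnd) :
    SplitsThroughPolynomial e := by
  have hretract : Function.LeftInverse e.rangeRestrict e.range.val := by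
    rintro ⟨_, f, rfl⟩
    exact Subtype.ext (DFunLike.congr_fun he f)
  have hrange : ¬ Function.Surjective (algebraMap P e.range) := by
    intro h
    choose c hc using fun i => h (e.rangeRestrict (X i))
    refine hconst ⟨c, algHom_ext fun i => ?_⟩
    simpa [constEnd] using congrArg Subtype.val (hc i)
  obtain ⟨θ⟩ := nonempty_algEquiv_polynomial_of_retract e.range.val e.rangeRestrict hretract
    (hcurve.trdeg_range_le_one he hconst) hrange
  refine ⟨e.range.val.comp θ, (θ.symm : e.range →ₐ[P] P[X]).comp e.rangeRestrict, fun f => ?_, ?_⟩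
  · simp only [AlgHom.comp_apply, hretract _]
    exact θ.symm_apply_apply f
  · ext1 i
    simp

theorem splitsThroughPolynomial_iff [Infinite P] {e : PolyEnd ι P} :
    SplitsThroughPolynomial e ↔
      IsIdempotentElem e ∧ e ∉ Set.range constEnd ∧ IsCurveLike e := by
  refine ⟨fun h => ⟨?_, h.notMem_range_constEnd, h.isCurveLike⟩,
    fun ⟨he, hconst, hcurve⟩ => hcurve.splitsThroughPolynomial he hconst⟩
  obtain ⟨i, r, hri, rfl⟩ := h
  refine AlgHom.ext fun f => ?_
  simp only [AlgHom.mul_apply, AlgHom.comp_apply, hri _]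

theorem splitsThroughPolynomial_map_iff [Infinite P] (τ : PolyEnd ι P ≃* PolyEnd ι P)
    {e : PolyEnd ι P} : SplitsThroughPolynomial (τ e) ↔ SplitsThroughPolynomial e := by
  simp only [splitsThroughPolynomial_iff, map_mem_range_constEnd_iff, isCurveLike_map_iff,
    IsIdempotentElem, ← map_mul, τ.injective.eq_iff]

end CurveLikeIdempotents

section AffineNormalizer

open Polynomial

variable {P : Type*} [Field P] {β : P → P}

/-- Conjugation by the bijection `β` turns invertible affine maps `x ↦ a * x + b` of the line into
affine maps. -/
def NormalizesAffineMaps (β : P → P) : Prop :=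
  ∀ a b, a ≠ 0 → ∃ m k, ∀ x, β (a * x + b) = m * β x + k

theorem eval_eq_of_comp_eq_X {R : Type*} [CommRing R] [IsDomain R] {p q : R[X]}
    (h : q.comp p = X) (x : R) : p.eval x = p.coeff 1 * x + p.coeff 0 := by
  have hdeg : q.natDegree * p.natDegree = 1 := by rw [← natDegree_comp, h, natDegree_X]
  conv_lhs => rw [eq_X_add_C_of_natDegree_le_one (Nat.eq_one_of_mul_eq_one_left hdeg).le]
  simp

theorem normalizesAffineMaps_of_polynomial [Infinite P] (hsurj : Function.Surjective β)
    (hβ : ∀ a b, ∃ p : P[X], ∀ x, p.eval (β x) = β (a * x + b)) : NormalizesAffineMaps β := by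
  intro a b ha
  obtain ⟨p, hp⟩ := hβ a b
  obtain ⟨q, hq⟩ := hβ a⁻¹ (-(a⁻¹ * b))
  have hqp : q.comp p = X := by
    refine Polynomial.funext (hsurj.forall.2 fun x => ?_)
    rw [eval_comp, hp, hq, eval_X, mul_add, inv_mul_cancel_left₀ ha, add_neg_cancel_right]
  exact ⟨p.coeff 1, p.coeff 0, fun x => by rw [← hp, eval_eq_of_comp_eq_X hqp]⟩

namespace NormalizesAffineMaps

theorem apply_mul (hβ : NormalizesAffineMaps β) (h₀ : β 0 = 0) (h₁ : β 1 = 1) (x y : P) :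
    β (x * y) = β x * β y := by
  rcases eq_or_ne x 0 with rfl | hx
  · rw [zero_mul, h₀, zero_mul]
  obtain ⟨m, k, h⟩ := hβ x 0 hx
  have hk : 0 = k := by simpa [h₀] using h 0
  have hm : β x = m := by simpa [h₁, ← hk] using h 1
  simpa [hm, ← hk] using h y

/-- The affine map corresponding to a nontrivial translation has no fixed point, so its slope
is `1`. -/
theorem apply_add (hβ : NormalizesAffineMaps β) (hbij : Function.Bijective β) (h₀ : β 0 = 0)
    (x y : P) : β (x + y) = β x + β y := by
  rcases eq_or_ne y 0 with rfl | hy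
  · rw [add_zero, h₀, add_zero]
  obtain ⟨m, k, h⟩ := hβ 1 y one_ne_zero
  have hk : β y = k := by simpa [h₀] using h 0
  have hm : m = 1 := by
    by_contra hm
    obtain ⟨z, hz⟩ := hbij.surjective (k / (1 - m))
    have hfix : β (1 * z + y) = β z := by
      rw [h, hz]
      field_simp [sub_ne_zero.2 (Ne.symm hm)]
      ring
    exact hy (by simpa using hbij.injective hfix)
  simpa [hm, hk] using h x

theorem affine_comp (hβ : NormalizesAffineMaps β) {a : P} (ha : a ≠ 0) (b : P) :
    NormalizesAffineMaps fun x => (β x - b) / a := by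
  intro u v hu
  obtain ⟨m, k, h⟩ := hβ u v hu
  refine ⟨m, (m * b + k - b) / a, fun x => ?_⟩
  simp only [h]
  field

theorem exists_ringEquiv_affine {β : P ≃ P} (hβ : NormalizesAffineMaps β) :
    ∃ (α : P ≃+* P) (a b : P), a ≠ 0 ∧ ∀ x, β x = a * α x + b := by
  have ha : β 1 - β 0 ≠ 0 := sub_ne_zero.2 (β.injective.ne one_ne_zero)
  let γ : P ≃ P := β.trans ((Equiv.subRight (β 0)).trans (Equiv.divRight₀ _ ha))
  have hγ : NormalizesAffineMaps γ := hβ.affine_comp ha (β 0)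
  have h₀ : γ 0 = 0 := by simp [γ]
  have h₁ : γ 1 = 1 := by simp [γ, ha]
  let α : P ≃+* P :=
    { γ with
      map_mul' := hγ.apply_mul h₀ h₁
      map_add' := hγ.apply_add γ.bijective h₀ }
  refine ⟨α, _, β 0, ha, fun x => ?_⟩
  have hα : α x = (β x - β 0) / (β 1 - β 0) := rfl
  rw [hα, mul_div_cancel₀ _ ha, sub_add_cancel]

end NormalizesAffineMaps

end AffineNormalizer

section Diagonal

open MvPolynomial
open scoped Polynomial

variable {R ι : Type*}

/-- The endomorphism substituting `f` for every variable, dual to the map `v ↦ (f v, f v, …)` of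
affine space into its diagonal. -/
noncomputable def diagEnd [CommSemiring R] (f : MvPolynomial ι R) : PolyEnd ι R :=
  aeval fun _ => f

theorem pointMap_diagEnd [CommSemiring R] (f : MvPolynomial ι R) (v : ι → R) :
    pointMap (diagEnd f) v = Function.const ι (eval v f) := by
  funext i
  simp [pointMap, diagEnd]

theorem splitsThroughPolynomial_diagEnd_X [CommRing R] (i₀ : ι) :
    SplitsThroughPolynomial (diagEnd (X i₀ : MvPolynomial ι R)) := by
  refine ⟨Polynomial.aeval (X i₀), aeval fun _ => Polynomial.X, fun p => ?_, ?_⟩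
  · simp [← Polynomial.aeval_algHom_apply]
  · ext1 i
    simp [diagEnd]

theorem exists_equiv_curve_eq [CommSemiring R] {τ : PolyEnd ι R ≃* PolyEnd ι R}
    {σ : Equiv.Perm (ι → R)} (hσ : ∀ s, Function.Semiconj σ (pointMap s) (pointMap (τ s))) (i₀ : ι)
    {i : R[X] →ₐ[R] MvPolynomial ι R} {r : MvPolynomial ι R →ₐ[R] R[X]}
    (hri : Function.LeftInverse r i) (hir : i.comp r = τ (diagEnd (X i₀))) :
    ∃ β : R ≃ R, (∀ x, eval (σ (Function.const ι x)) (i Polynomial.X) = β x) ∧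
      ∀ x, curve r (β x) = σ (Function.const ι x) := by
  have hproj (c : ι → R) :
      curve r (eval (σ c) (i Polynomial.X)) = σ (Function.const ι (c i₀)) := by
    rw [curve_eval, hir, ← hσ, pointMap_diagEnd, eval_X]
  refine ⟨⟨fun x => eval (σ (Function.const ι x)) (i Polynomial.X),
    fun y => σ.symm (curve r y) i₀, fun x => ?_, fun y => ?_⟩, fun _ => rfl, fun x => hproj _⟩
  · beta_reduce
    rw [hproj, Equiv.symm_apply_apply, Function.const_apply, Function.const_apply]
  · beta_reduce
    rw [← hproj, Equiv.apply_symm_apply, eval_curve_of_leftInverse hri,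
      eval_curve_of_leftInverse hri]

variable {P : Type*} [Field P] {τ : PolyEnd ι P ≃* PolyEnd ι P} {σ : Equiv.Perm (ι → P)}

theorem normalizesAffineMaps_of_curve_eq [Infinite P]
    (hσ : ∀ s, Function.Semiconj σ (pointMap s) (pointMap (τ s))) (i₀ : ι) {β : P ≃ P}
    {f : MvPolynomial ι P} {r : MvPolynomial ι P →ₐ[P] P[X]}
    (hf : ∀ x, eval (σ (Function.const ι x)) f = β x)
    (hr : ∀ x, curve r (β x) = σ (Function.const ι x)) : NormalizesAffineMaps β := by
  refine normalizesAffineMaps_of_polynomial β.surjective fun a b =>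
    ⟨r (τ (diagEnd (C a * X i₀ + C b)) f), fun x => ?_⟩
  rw [polynomial_eval_algHom_apply, hr, eval_algHom_apply, ← hσ, pointMap_diagEnd, hf]
  simp

theorem exists_ringEquiv_curve_eq [Infinite P]
    (hσ : ∀ s, Function.Semiconj σ (pointMap s) (pointMap (τ s))) (i₀ : ι) :
    ∃ (α : P ≃+* P) (f : MvPolynomial ι P) (r : MvPolynomial ι P →ₐ[P] P[X]),
      (∀ x, eval (σ (Function.const ι x)) f = α x) ∧
        ∀ x, curve r (α x) = σ (Function.const ι x) := by
  obtain ⟨i, r, hri, hir⟩ :=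
    (splitsThroughPolynomial_map_iff τ).2 (splitsThroughPolynomial_diagEnd_X i₀)
  obtain ⟨β, hf, hr⟩ := exists_equiv_curve_eq hσ i₀ hri hir
  obtain ⟨α, a, b, ha, hβ⟩ :=
    (normalizesAffineMaps_of_curve_eq hσ i₀ hf hr).exists_ringEquiv_affine
  refine ⟨α, C a⁻¹ * (i Polynomial.X - C b),
    (Polynomial.aeval (Polynomial.C a * Polynomial.X + Polynomial.C b)).comp r,
    fun x => ?_, fun x => ?_⟩
  · simp [hf, hβ, ha]
  · rw [← hr, hβ]
    funext j
    simp [curve, ← Polynomial.comp_eq_aeval]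

theorem ringEquiv_comp_symm_comp {S T : Type*} [Mul S] [Add S] [Mul T] [Add T] (α : S ≃+* T)
    (v : ι → T) : α ∘ α.symm ∘ v = v :=
  funext fun i => α.apply_symm_apply (v i)

theorem exists_pointMap_eq_comp [Infinite P]
    (hσ : ∀ s, Function.Semiconj σ (pointMap s) (pointMap (τ s))) :
    ∃ (α : P ≃+* P) (s t : PolyEnd ι P),
      (∀ v, pointMap s v = σ.symm (α ∘ v)) ∧ ∀ v, pointMap t v = α.symm ∘ σ v := by
  rcases isEmpty_or_nonempty ι with hι | ⟨⟨i₀⟩⟩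
  · exact ⟨RingEquiv.refl P, 1, 1, fun _ => Subsingleton.elim _ _, fun _ => Subsingleton.elim _ _⟩
  obtain ⟨α, f, r, hf, hr⟩ := exists_ringEquiv_curve_eq hσ i₀
  refine ⟨α, aeval fun i => map (α.symm : P →+* P) (τ (diagEnd (X i)) f),
    aeval fun i => τ.symm ((Polynomial.aeval (X i)).comp r) (X i₀),
    fun v => funext fun i => ?_, fun v => funext fun i => ?_⟩
  · obtain ⟨c, rfl⟩ : ∃ c, α.symm ∘ σ c = v := ⟨σ.symm (α ∘ v), by ext; simp⟩
    rw [ringEquiv_comp_symm_comp, σ.symm_apply_apply, pointMap, aeval_X]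
    calc eval (α.symm ∘ σ c) (map (α.symm : P →+* P) (τ (diagEnd (X i)) f))
        = α.symm (eval (σ c) (τ (diagEnd (X i)) f)) := (map_eval (α.symm : P →+* P) _ _).symm
      _ = c i := by
        rw [eval_algHom_apply, ← hσ, pointMap_diagEnd, eval_X, hf, α.symm_apply_apply]
  · let F : PolyEnd ι P := (Polynomial.aeval (X i)).comp r
    have hF (w : ι → P) : pointMap F w = σ (Function.const ι (α.symm (w i))) := by
      rw [← hr, α.apply_symm_apply, ← curve_eval, Polynomial.aeval_X, eval_X]
    have hF' : pointMap (τ.symm F) v = Function.const ι (α.symm (σ v i)) :=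
      σ.injective (by rw [hσ, τ.apply_symm_apply, hF])
    simpa [pointMap] using congrFun hF' i₀

theorem eval_map_algHom_apply {α : P ≃+* P} {s : PolyEnd ι P}
    (hs : ∀ v, pointMap s v = σ.symm (α ∘ v)) (c : ι → P) (q : MvPolynomial ι P) :
    eval (σ c) (map (α : P →+* P) (s q)) = α (eval c q) := by
  have hc : pointMap s (α.symm ∘ σ c) = c := by
    rw [hs, ringEquiv_comp_symm_comp, σ.symm_apply_apply]
  calc eval (σ c) (map (α : P →+* P) (s q))
      = eval (α ∘ α.symm ∘ σ c) (map (α : P →+* P) (s q)) := by rw [ringEquiv_comp_symm_comp]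
    _ = α (eval (α.symm ∘ σ c) (s q)) := (map_eval (α : P →+* P) _ _).symm
    _ = α (eval c q) := by rw [eval_algHom_apply, hc]

end Diagonal

open MvPolynomial in
theorem mainTheorem1_general {P ι : Type*} [Field P] [Infinite P]
    (τ : (MvPolynomial ι P →ₐ[P] MvPolynomial ι P) ≃*
      (MvPolynomial ι P →ₐ[P] MvPolynomial ι P)) :
    ∃ (α : P ≃+* P) (η : MvPolynomial ι P ≃ₐ[P] MvPolynomial ι P),
      ∀ s, ⇑(τ s) = (η.toEquiv.trans (mapEquiv ι α).toEquiv) ∘ s ∘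
        (η.toEquiv.trans (mapEquiv ι α).toEquiv).symm := by
  obtain ⟨σ, hσ⟩ := exists_perm_semiconj_pointMap τ
  obtain ⟨α, s, t, hs, ht⟩ := exists_pointMap_eq_comp hσ
  have hst : s * t = 1 := pointMap_injective (funext fun v => by
    rw [pointMap_mul, hs, ht, σ.apply_symm_apply, pointMap_one]
    exact ringEquiv_comp_symm_comp α.symm v)
  have hts : t * s = 1 := pointMap_injective (funext fun v => by
    rw [pointMap_mul, hs, ht, ringEquiv_comp_symm_comp, σ.symm_apply_apply, pointMap_one])
  let η := AlgEquiv.ofAlgHom s t hst hts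
  let μ := η.toEquiv.trans (mapEquiv ι α).toEquiv
  have hμ (c : ι → P) (q : MvPolynomial ι P) : eval (σ c) (μ q) = α (eval c q) :=
    eval_map_algHom_apply hs c q
  refine ⟨α, η, fun u => funext (μ.surjective.forall.2 fun q => MvPolynomial.funext
    (σ.surjective.forall.2 fun c => ?_))⟩
  calc eval (σ c) (τ u (μ q)) = α (eval c (u q)) := by
        rw [eval_algHom_apply, ← hσ, hμ, eval_algHom_apply]
    _ = eval (σ c) (μ (u (μ.symm (μ q)))) := by rw [μ.symm_apply_apply, hμ]

theorem mainTheorem1 {P : Type*} [Field P] [Infinite P] (n : ℕ)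
    (τ : (MvPolynomial (Fin n) P →ₐ[P] MvPolynomial (Fin n) P) ≃*
      (MvPolynomial (Fin n) P →ₐ[P] MvPolynomial (Fin n) P)) :
    IsSemiInner τ :=
  mainTheorem1_general τ
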